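/- Let $\mathbb P_1$ be the real projective line with homogeneous coordinates $(u:v)$, identified with the unit circle $\mathbb S_1$ by $(u:v)\mapsto\bigl(\frac{u^2-v^2}{u^2+v^2},\frac{2uv}{u^2+v^2}\bigr)$, and identify $\mathbb R^3$ with the pure quaternions. A *bounded rational function* on $\mathbb P_1$ is a quotient of two real homogeneous polynomials in $u,v$ of the same degree whose denominator has no zero on $\mathbb P_1$; a *bounded rational curve* is a map $\mathbf R\colon\mathbb P_1\to\mathbb R^3$ whose coordinates are bounded rational functions, and it is *regular* if its derivative with respect to arc length on $\mathbb S_1$ vanishes nowhere. A *rational spherical motion* is given by a homogeneous quaternion polynomial $\mathcal A(u,v)$ (real indeterminates commuting with the coefficients) without zeros on $\mathbb P_1$; it moves a point $\mathbf p\in\mathbb R^3$ along the trajectory $\mathcal A\mathbf p\mathcal A^*/(\mathcal A\mathcal A^*)$. A *rational motion extending $\mathcal A$* is a family of maps $\mathbf p\mapsto \mathbf R+\mathcal A\mathbf p\mathcal A^*/(\mathcal A\mathcal A^*)$, with a translation part $\mathbf R\colon\mathbb P_1\to\mathbb R^3$, all of whose trajectories are bounded rational curves. It is a *framing motion* of the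 curve $\mathbf R$ (the trajectory of the origin), with tangential frame axis a unit vector $\mathbf e$, if $\mathcal A\mathbf e\mathcal A^*/(\mathcal A\mathcal A^*)$ is at every parameter value parallel to the derivative of $\mathbf R$. **Theorem.** Let $\mathcal A(u,v)$ be a rational spherical motion, let $\mathbf e\in\mathbb R^3$ be a unit vector (for example $\mathbf e=\mathbf i$), and put $\mathbf T=\mathcal A\mathbf e\mathcal A^*/(\mathcal A\mathcal A^*)$. The following are equivalent: 1. $\mathcal A$ can be extended to a rational framing motion, with tangential frame axis $\mathbf e$, of a regular bounded rational curve. 2. The origin lies in the relative interior of the convex hull of the spherical trajectory $\mathbf T(\mathbb P_1)$ of the point $\mathbf e$ (that is, in its interior relative to its affine hull). 3. There is a bounded rational function $L$ on $\mathbb P_1$ with $L>0$ everywhere such that the integral of $L\,\mathbf T$ with respect to arc length along $\mathbb S_1$ is a rational closed curve, i.e. there is a bounded rational curve $\mathbf R\colon\mathbb P_1\to\mathbb R^3$ with $\mathbf R(b)-\mathbf R(a)=\int_{a}^{b}L\,\mathbf T\,\mathrm d\mathbb S_1$ for every arc of the circle from $a$ to $b$. -/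

import Mathlib

open scoped Quaternion

noncomputable section

namespace FramingMotion

/-- Euclidean three-space. -/
abbrev E3 : Type := EuclideanSpace ℝ (Fin 3)

/-- The real projective line, with homogeneous coordinates `(u : v) = (w 0 : w 1)`. -/
abbrev P1 : Type := Projectivization ℝ (Fin 2 → ℝ)

/-- Quaternion polynomials in two indeterminates which commute with the coefficients. -/
abbrev QuatPoly : Type := ℍ[MvPolynomial (Fin 2) ℝ]

/-- The value of a quaternion polynomial at a real pair `w = (u, v)`. -/
def evalQ (w : Fin 2 → ℝ) (A : QuatPoly) : ℍ[ℝ] :=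
  ⟨MvPolynomial.eval w A.re, MvPolynomial.eval w A.imI,
    MvPolynomial.eval w A.imJ, MvPolynomial.eval w A.imK⟩

/-- A vector `(x, y, z)` regarded as the pure quaternion `x i + y j + z k`. -/
def toQuat (p : E3) : ℍ[ℝ] := ⟨0, p 0, p 1, p 2⟩

/-- The vector part of a quaternion. -/
def vecPart (q : ℍ[ℝ]) : E3 := !₂[q.imI, q.imJ, q.imK]

/-- The rotation `p ↦ (q p q*) / (q q*)` of three-space given by a quaternion `q ≠ 0`
(the quaternion `q q*` is the real number `normSq q`). -/
def rot (q : ℍ[ℝ]) (p : E3) : E3 :=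
  (Quaternion.normSq q)⁻¹ • vecPart (q * toQuat p * star q)

theorem rot_smul (q : ℍ[ℝ]) {c : ℝ} (hc : c ≠ 0) (p : E3) : rot (c • q) p = rot q p := by
  have h1 : c • q * toQuat p * star (c • q) = (c ^ 2) • (q * toQuat p * star q) := by
    simp [smul_smul, pow_two]
  have h2 : ∀ (a : ℝ) (x : ℍ[ℝ]), vecPart (a • x) = a • vecPart x := by
    intro a x
    ext i
    fin_cases i <;> simp [vecPart]
  unfold rot
  rw [h1, h2, Quaternion.normSq_smul, smul_smul]
  congr 1
  field_simp

/-- A rational spherical motion: a homogeneous quaternion polynomial `A(u, v)` that vanishes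
nowhere on the real projective line. -/
structure SphericalMotion where
  /-- the quaternion polynomial -/
  poly : QuatPoly
  /-- its degree -/
  deg : ℕ
  homog_re : poly.re.IsHomogeneous deg
  homog_imI : poly.imI.IsHomogeneous deg
  homog_imJ : poly.imJ.IsHomogeneous deg
  homog_imK : poly.imK.IsHomogeneous deg
  ne_zero : ∀ w : Fin 2 → ℝ, w ≠ 0 → evalQ w poly ≠ 0

theorem SphericalMotion.evalQ_smul (A : SphericalMotion) (c : ℝ) (w : Fin 2 → ℝ) :
    evalQ (c • w) A.poly = c ^ A.deg • evalQ w A.poly := by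
  have key : ∀ f : MvPolynomial (Fin 2) ℝ, f.IsHomogeneous A.deg →
      MvPolynomial.eval (c • w) f = c ^ A.deg * MvPolynomial.eval w f := by
    intro f hf
    rw [MvPolynomial.eval_eq, MvPolynomial.eval_eq, Finset.mul_sum]
    refine Finset.sum_congr rfl fun m hm => ?_
    have hd : ∑ i, m i = A.deg := by
      have := hf (MvPolynomial.mem_support_iff.mp hm)
      simpa [Finsupp.weight_apply, Finsupp.sum_fintype] using this
    simp only [Pi.smul_apply, smul_eq_mul, mul_pow, Finset.prod_mul_distrib]
    rw [Finset.prod_pow_eq_pow_sum, Finset.sum_subset (Finset.subset_univ _), hd]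
    · ring
    · intro i _ hi
      simpa using hi
  ext
  · exact key _ A.homog_re
  · exact key _ A.homog_imI
  · exact key _ A.homog_imJ
  · exact key _ A.homog_imK

/-- The trajectory `(u : v) ↦ (A(u,v) p A(u,v)*) / (A(u,v) A(u,v)*)` of the point `p` under the
spherical motion `A`. -/
def SphericalMotion.traj (A : SphericalMotion) (p : E3) : P1 → E3 :=
  Projectivization.lift (fun w : { w : Fin 2 → ℝ // w ≠ 0 } => rot (evalQ w.1 A.poly) p)
    (by
      intro a b t h
      have ht : t ≠ 0 := by
        rintro rfl
        exact a.2 (by simpa using h)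
      change rot (evalQ a.1 A.poly) p = rot (evalQ b.1 A.poly) p
      rw [h, A.evalQ_smul, rot_smul _ (pow_ne_zero _ ht)])

/-- A bounded rational function on the projective line: a quotient of two homogeneous polynomials
of the same degree whose denominator has no real roots. -/
def IsBoundedRational (f : P1 → ℝ) : Prop :=
  ∃ (n : ℕ) (N D : MvPolynomial (Fin 2) ℝ), N.IsHomogeneous n ∧ D.IsHomogeneous n ∧
    ∀ (w : Fin 2 → ℝ) (hw : w ≠ 0), MvPolynomial.eval w D ≠ 0 ∧
      f (Projectivization.mk ℝ w hw) = MvPolynomial.eval w N / MvPolynomial.eval w D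

/-- A bounded rational curve: all coordinate functions are bounded rational functions. -/
def IsBoundedRationalCurve (r : P1 → E3) : Prop :=
  ∀ i : Fin 3, IsBoundedRational (fun x => r x i)

/-- The point `(cos (θ/2) : sin (θ/2))` of the projective line. Under the identification
`(u : v) ↔ ((u² - v²) / (u² + v²), 2uv / (u² + v²))` with the unit circle it is the point
`(cos θ, sin θ)`, so `θ` is the arc length on the oriented circle. -/
def circlePt (θ : ℝ) : P1 :=
  Projectivization.mk ℝ ![Real.cos (θ / 2), Real.sin (θ / 2)] (by
    intro h
    have h0 : Real.cos (θ / 2) = 0 := by simpa using congrFun h 0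
    have h1 : Real.sin (θ / 2) = 0 := by simpa using congrFun h 1
    have := Real.sin_sq_add_cos_sq (θ / 2)
    rw [h0, h1] at this
    norm_num at this)

/-- The tangent map of `r`, applied to the positive unit tangent vector of the circle at the
point `(cos θ, sin θ)`. -/
def velocity (r : P1 → E3) (θ : ℝ) : E3 := deriv (fun s => r (circlePt s)) θ

/-- A regular bounded rational curve: all points are finite and there are no cusps. -/
def IsRegularBoundedRationalCurve (r : P1 → E3) : Prop :=
  IsBoundedRationalCurve r ∧ ∀ θ : ℝ, velocity r θ ≠ 0

/-- `M x p` is the position of the point `p` at the parameter `x`. The motion `M` extends the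
spherical motion `A` if its rotational part is `A`: it is `A` followed by some translation. -/
def Extends (M : P1 → E3 → E3) (A : SphericalMotion) : Prop :=
  ∃ r : P1 → E3, ∀ (x : P1) (p : E3), M x p = r x + A.traj p x

/-- A motion is (bounded) rational if all its trajectories are (bounded) rational curves. -/
def IsBoundedRationalMotion (M : P1 → E3 → E3) : Prop :=
  ∀ p : E3, IsBoundedRationalCurve (fun x => M x p)

/-- `M` is a framing motion of the curve `r`, with tangential frame axis `e`: it moves the origin
along `r`, and the moved axis `e` is everywhere parallel to the derivative of `r`. -/
def IsFramingMotion (M : P1 → E3 → E3) (e : E3) (r : P1 → E3) : Prop :=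
  (∀ x, M x 0 = r x) ∧
    ∀ θ : ℝ, ∃ c : ℝ, velocity r θ = c • (M (circlePt θ) e - M (circlePt θ) 0)

/-- `r` is recovered, on every arc of the circle, as the line integral of the vector field `F`
with respect to arc length. -/
def IsCircleIntegral (r F : P1 → E3) : Prop :=
  ∀ a b : ℝ, r (circlePt b) = r (circlePt a) + ∫ s in a..b, F (circlePt s)

end FramingMotion

end

/-! Write `T` for the spherical trajectory of `e`. If a regular curve is framed by `T`, its
derivative is `L • T`, where `L` is the inner product of the derivative with the unit vector `T`.
This `L` is bounded rational and has no zero, so it has constant sign; reflecting the curve in the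
origin makes it positive. Conversely, an integral curve of `L • T` with `L > 0` is regular and
framed by `T`.

The convexity condition is used in dual form: the origin is in the relative interior of a nonempty
convex set exactly when every linear functional that is nonnegative on the set vanishes on it. If `L
• T` integrates to a closed curve `r` and `f ∘ T ≥ 0`, then `f ∘ r` is monotone and periodic, hence
constant, so `f ∘ T = 0`.

For the converse write `T = P / Q` with `P`, `Q` trigonometric polynomials and `Q > 0`. The vectors
`∫ g P`, for positive trigonometric polynomials `g`, form a convex set. A functional `f` nonnegative
on this set satisfies `f ∘ P ≥ 0` (`nonneg_of_forall_integral_mul_nonneg`), hence `f ∘ P = 0` by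
hypothesis, so `f` vanishes on the set. By the dual criterion `∫ g P = 0` for some `g`. With `L = g
Q` the field `L • T = g P` is a trigonometric polynomial of mean zero, whose antiderivative is again
one, hence rational on the projective line. -/

/-! ### Linear functionals and the relative interior -/

theorem Convex.exists_nonneg_of_zero_notMem_interior {V : Type*} [NormedAddCommGroup V]
    [NormedSpace ℝ V] [FiniteDimensional ℝ V] {C : Set V} (hC : Convex ℝ C) (hne : C.Nonempty)
    (h0 : (0 : V) ∉ interior C) : ∃ f : V →ₗ[ℝ] ℝ, f ≠ 0 ∧ ∀ x ∈ C, 0 ≤ f x := by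
  by_cases hi : (interior C).Nonempty
  · obtain ⟨f, hf⟩ := geometric_hahn_banach_point_open hC.interior isOpen_interior h0
    refine ⟨f.toLinearMap, ?_, ?_⟩
    · intro h
      obtain ⟨x, hx⟩ := hi
      have h1 := hf x hx
      have h2 : f x = 0 := LinearMap.congr_fun h x
      simp [h2] at h1
    · intro x hx
      have hx' : x ∈ closure (interior C) := by
        rw [hC.closure_interior_eq_closure_of_nonempty_interior hi]
        exact subset_closure hx
      have hcl : IsClosed {y | 0 ≤ f y} := isClosed_le continuous_const f.continuous
      refine closure_minimal (fun y hy => ?_) hcl hx'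
      have h1 := hf y hy
      rw [map_zero] at h1
      exact h1.le
  -- With empty interior, `C` spans a proper affine subspace. A functional that kills its direction
  -- is constant on `C`, and its sign can be chosen.
  · rw [hC.interior_nonempty_iff_affineSpan_eq_top] at hi
    obtain ⟨x₀, hx₀⟩ := hne
    have hdir : (affineSpan ℝ C).direction < ⊤ := by
      rw [lt_top_iff_ne_top]
      intro h
      exact hi ((AffineSubspace.direction_eq_top_iff_of_nonempty
        ⟨x₀, subset_affineSpan ℝ C hx₀⟩).1 h)
    obtain ⟨f, hf, hle⟩ := Submodule.exists_le_ker_of_lt_top _ hdir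
    have key : ∀ x ∈ C, f x = f x₀ := by
      intro x hx
      have := hle (AffineSubspace.vsub_mem_direction (subset_affineSpan ℝ C hx)
        (subset_affineSpan ℝ C hx₀))
      simpa [sub_eq_zero] using this
    rcases le_total 0 (f x₀) with h | h
    · exact ⟨f, hf, fun x hx => by rw [key x hx]; exact h⟩
    · refine ⟨-f, neg_ne_zero.2 hf, fun x hx => ?_⟩
      rw [LinearMap.neg_apply, key x hx]
      linarith

/-- From the origin one can move a little in the direction `-x` without leaving `C`; there `f`
equals `-t * f x` with `t > 0`, which must be nonnegative. -/
theorem eq_zero_of_zero_mem_intrinsicInterior {V : Type*} [NormedAddCommGroup V]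
    [NormedSpace ℝ V] {C : Set V} (h0 : (0 : V) ∈ intrinsicInterior ℝ C) (f : V →ₗ[ℝ] ℝ)
    (hf : ∀ x ∈ C, 0 ≤ f x) {x : V} (hx : x ∈ C) : f x = 0 := by
  obtain ⟨y, hy, hy0⟩ := mem_intrinsicInterior.1 h0
  have hmem : ∀ t : ℝ, -(t • x) ∈ affineSpan ℝ C := by
    intro t
    have h := AffineMap.lineMap_mem (-t) (hy0 ▸ y.2 : (0 : V) ∈ affineSpan ℝ C)
      (subset_affineSpan ℝ C hx)
    simpa [AffineMap.lineMap_apply] using h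
  let γ : ℝ → affineSpan ℝ C := fun t => ⟨-(t • x), hmem t⟩
  have hγ : Continuous γ := by
    refine Continuous.subtype_mk ?_ _
    fun_prop
  have hγ0 : γ 0 = y := Subtype.ext (by simp [γ, hy0])
  have hev : ∀ᶠ t in nhds (0 : ℝ), γ t ∈ interior ((↑) ⁻¹' C : Set (affineSpan ℝ C)) := by
    refine hγ.continuousAt.eventually_mem ?_
    rw [hγ0]
    exact isOpen_interior.mem_nhds hy
  obtain ⟨t, ht, ht0⟩ := ((hev.filter_mono nhdsWithin_le_nhds).and
    (self_mem_nhdsWithin : ∀ᶠ t in nhdsWithin (0 : ℝ) (Set.Ioi 0), t ∈ Set.Ioi (0 : ℝ))).exists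
  have htC : γ t ∈ ((↑) ⁻¹' C : Set (affineSpan ℝ C)) := interior_subset ht
  have h1 := hf _ htC
  have h2 : f (-(t • x)) = -(t * f x) := by simp
  change 0 ≤ f (-(t • x)) at h1
  rw [h2] at h1
  have h3 := hf x hx
  have ht0' : 0 < t := ht0
  nlinarith

/-- Inside the linear span `W` of `C` the origin is even an ordinary interior point. Otherwise a
nonzero functional on `W` is nonnegative on `C`; its extension to `V` vanishes on `C` by hypothesis,
hence on `W`, a contradiction. -/
theorem Convex.zero_mem_intrinsicInterior {V : Type*} [NormedAddCommGroup V]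
    [NormedSpace ℝ V] [FiniteDimensional ℝ V] {C : Set V} (hC : Convex ℝ C) (hne : C.Nonempty)
    (h : ∀ f : V →ₗ[ℝ] ℝ, (∀ x ∈ C, 0 ≤ f x) → ∀ x ∈ C, f x = 0) :
    (0 : V) ∈ intrinsicInterior ℝ C := by
  let W : Submodule ℝ V := Submodule.span ℝ C
  let C' : Set W := W.subtype ⁻¹' C
  have himg : W.subtypeₗᵢ.toAffineIsometry '' C' = C := by
    ext x
    constructor
    · rintro ⟨y, hy, rfl⟩
      exact hy
    · intro hx
      exact ⟨⟨x, Submodule.subset_span hx⟩, hx, rfl⟩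
  have hC' : Convex ℝ C' := hC.linear_preimage W.subtype
  have hne' : C'.Nonempty := by
    obtain ⟨x, hx⟩ := hne
    exact ⟨⟨x, Submodule.subset_span hx⟩, hx⟩
  have h0 : (0 : W) ∈ interior C' := by
    by_contra hcon
    obtain ⟨f, hf, hpos⟩ := hC'.exists_nonneg_of_zero_notMem_interior hne' hcon
    obtain ⟨g, hg⟩ := f.exists_extend
    have hgf : ∀ w : W, g w = f w := fun w => LinearMap.congr_fun hg w
    have hz := h g (fun x hx => by
      have := hpos ⟨x, Submodule.subset_span hx⟩ hx
      rwa [← hgf] at this)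
    apply hf
    ext w
    rw [← hgf, LinearMap.zero_apply]
    have hle : W ≤ LinearMap.ker g := Submodule.span_le.2 fun x hx => hz x hx
    exact hle w.2
  rw [← himg, AffineIsometry.intrinsicInterior_image]
  exact ⟨0, interior_subset_intrinsicInterior h0, rfl⟩

namespace FramingMotion

/-! ### Bounded rational functions on the projective line -/

theorem eval_smul_of_isHomogeneous {f : MvPolynomial (Fin 2) ℝ} {n : ℕ}
    (hf : f.IsHomogeneous n) (c : ℝ) (w : Fin 2 → ℝ) :
    MvPolynomial.eval (c • w) f = c ^ n * MvPolynomial.eval w f := by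
  rw [MvPolynomial.eval_eq, MvPolynomial.eval_eq, Finset.mul_sum]
  refine Finset.sum_congr rfl fun m hm => ?_
  have hd : ∑ i, m i = n := by
    have := hf (MvPolynomial.mem_support_iff.mp hm)
    simpa [Finsupp.weight_apply, Finsupp.sum_fintype] using this
  simp only [Pi.smul_apply, smul_eq_mul, mul_pow, Finset.prod_mul_distrib]
  rw [Finset.prod_pow_eq_pow_sum, Finset.sum_subset (Finset.subset_univ _), hd]
  · ring
  · intro i _ hi
    simpa using hi

theorem exists_isBoundedRational {n : ℕ} {N D : MvPolynomial (Fin 2) ℝ} (hN : N.IsHomogeneous n)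
    (hD : D.IsHomogeneous n) (h0 : ∀ w : Fin 2 → ℝ, w ≠ 0 → MvPolynomial.eval w D ≠ 0) :
    ∃ f : P1 → ℝ, IsBoundedRational f ∧ ∀ (w : Fin 2 → ℝ) (hw : w ≠ 0),
      f (Projectivization.mk ℝ w hw) = MvPolynomial.eval w N / MvPolynomial.eval w D := by
  have key : ∀ (w : Fin 2 → ℝ) (hw : w ≠ 0),
      MvPolynomial.eval (Projectivization.mk ℝ w hw).rep N /
        MvPolynomial.eval (Projectivization.mk ℝ w hw).rep D =
      MvPolynomial.eval w N / MvPolynomial.eval w D := by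
    intro w hw
    obtain ⟨a, ha⟩ := Projectivization.exists_smul_eq_mk_rep ℝ w hw
    have ha' : (a : ℝ) • w = (Projectivization.mk ℝ w hw).rep := ha
    rw [← ha', eval_smul_of_isHomogeneous hN, eval_smul_of_isHomogeneous hD]
    exact mul_div_mul_left _ _ (pow_ne_zero _ a.ne_zero)
  exact ⟨fun x => MvPolynomial.eval x.rep N / MvPolynomial.eval x.rep D,
    ⟨n, N, D, hN, hD, fun w hw => ⟨h0 w hw, key w hw⟩⟩, key⟩

namespace IsBoundedRational

theorem const (c : ℝ) : IsBoundedRational fun _ => c :=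
  ⟨0, MvPolynomial.C c, 1, MvPolynomial.isHomogeneous_C _ _, MvPolynomial.isHomogeneous_one _ _,
    fun w _ => by simp⟩

theorem add {f g : P1 → ℝ} (hf : IsBoundedRational f) (hg : IsBoundedRational g) :
    IsBoundedRational fun x => f x + g x := by
  obtain ⟨n, N, D, hN, hD, h⟩ := hf
  obtain ⟨m, N', D', hN', hD', h'⟩ := hg
  refine ⟨n + m, N * D' + D * N', D * D', (hN.mul hD').add (hD.mul hN'), hD.mul hD',
    fun w hw => ?_⟩
  obtain ⟨h1, h2⟩ := h w hw
  obtain ⟨h3, h4⟩ := h' w hw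
  simp only [map_mul, map_add]
  refine ⟨mul_ne_zero h1 h3, ?_⟩
  rw [h2, h4, div_add_div _ _ h1 h3]

theorem mul {f g : P1 → ℝ} (hf : IsBoundedRational f) (hg : IsBoundedRational g) :
    IsBoundedRational fun x => f x * g x := by
  obtain ⟨n, N, D, hN, hD, h⟩ := hf
  obtain ⟨m, N', D', hN', hD', h'⟩ := hg
  refine ⟨n + m, N * N', D * D', hN.mul hN', hD.mul hD', fun w hw => ?_⟩
  obtain ⟨h1, h2⟩ := h w hw
  obtain ⟨h3, h4⟩ := h' w hw
  simp only [map_mul]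
  refine ⟨mul_ne_zero h1 h3, ?_⟩
  rw [h2, h4, div_mul_div_comm]

theorem neg {f : P1 → ℝ} (hf : IsBoundedRational f) : IsBoundedRational fun x => -f x := by
  simpa using (const (-1)).mul hf

end IsBoundedRational

/-! ### The circle parameter and differentiation along the circle -/

theorem circlePt_surjective : Function.Surjective circlePt := by
  intro x
  induction x using Projectivization.ind with
  | h w hw =>
    let z : ℂ := ⟨w 0, w 1⟩
    have hz : z ≠ 0 := by
      intro h
      apply hw
      ext i
      fin_cases i
      · exact congrArg Complex.re h
      · exact congrArg Complex.im h
    refine ⟨2 * z.arg, ?_⟩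
    unfold circlePt
    rw [Projectivization.mk_eq_mk_iff']
    refine ⟨‖z‖⁻¹, ?_⟩
    have h2 : 2 * z.arg / 2 = z.arg := by ring
    have hn : ‖z‖ ≠ 0 := norm_ne_zero_iff.2 hz
    ext i
    fin_cases i
    · simp [h2, Complex.cos_arg hz, z, div_eq_inv_mul]
    · simp [h2, Complex.sin_arg, z, div_eq_inv_mul]

theorem circlePt_add_two_pi (θ : ℝ) : circlePt (θ + 2 * Real.pi) = circlePt θ := by
  unfold circlePt
  rw [Projectivization.mk_eq_mk_iff']
  -- A full turn negates the half-angle vector, which gives the same projective point.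
  refine ⟨-1, ?_⟩
  have h : (θ + 2 * Real.pi) / 2 = θ / 2 + Real.pi := by ring
  ext i
  fin_cases i <;> simp [h, Real.cos_add_pi, Real.sin_add_pi]

/-- The derivation `(u ∂/∂v - v ∂/∂u) / 2`, which is the derivative along the circle. -/
noncomputable def circleDeriv (f : MvPolynomial (Fin 2) ℝ) : MvPolynomial (Fin 2) ℝ :=
  MvPolynomial.C (1 / 2) *
    (MvPolynomial.X 0 * MvPolynomial.pderiv 1 f - MvPolynomial.X 1 * MvPolynomial.pderiv 0 f)

theorem isHomogeneous_circleDeriv {f : MvPolynomial (Fin 2) ℝ} {n : ℕ} (hf : f.IsHomogeneous n) :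
    (circleDeriv f).IsHomogeneous n := by
  -- Partial derivatives have degree `n - 1`, truncated at zero, so constants are treated apart.
  rcases Nat.eq_zero_or_pos n with rfl | hn
  · rw [← MvPolynomial.totalDegree_zero_iff_isHomogeneous,
      MvPolynomial.totalDegree_eq_zero_iff_eq_C] at hf
    rw [circleDeriv, hf]
    simpa using MvPolynomial.isHomogeneous_zero (Fin 2) ℝ 0
  · have key : ∀ i j : Fin 2,
        (MvPolynomial.X i * MvPolynomial.pderiv j f).IsHomogeneous n := by
      intro i j
      have := (MvPolynomial.isHomogeneous_X ℝ i).mul (hf.pderiv (i := j))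
      rwa [Nat.add_sub_cancel' hn] at this
    have := (MvPolynomial.isHomogeneous_C (Fin 2) (1 / 2 : ℝ)).mul ((key 0 1).sub (key 1 0))
    rwa [zero_add] at this

/-- The unit vector `(cos (θ/2), sin (θ/2))`, which represents the point `circlePt θ`. -/
noncomputable def halfAngleVec (θ : ℝ) : Fin 2 → ℝ := ![Real.cos (θ / 2), Real.sin (θ / 2)]

theorem halfAngleVec_ne_zero (θ : ℝ) : halfAngleVec θ ≠ 0 := by
  intro h
  have h0 : Real.cos (θ / 2) = 0 := by simpa [halfAngleVec] using congrFun h 0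
  have h1 : Real.sin (θ / 2) = 0 := by simpa [halfAngleVec] using congrFun h 1
  have := Real.sin_sq_add_cos_sq (θ / 2)
  rw [h0, h1] at this
  norm_num at this

theorem circlePt_eq_mk (θ : ℝ) :
    circlePt θ = Projectivization.mk ℝ (halfAngleVec θ) (halfAngleVec_ne_zero θ) := rfl

theorem hasDerivAt_eval_halfAngleVec (f : MvPolynomial (Fin 2) ℝ) (θ : ℝ) :
    HasDerivAt (fun t => MvPolynomial.eval (halfAngleVec t) f)
      (MvPolynomial.eval (halfAngleVec θ) (circleDeriv f)) θ := by
  induction f using MvPolynomial.induction_on with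
  | C a => simpa [circleDeriv] using hasDerivAt_const θ a
  | add p q hp hq =>
    simp only [map_add]
    refine (hp.fun_add hq).congr_deriv ?_
    simp only [circleDeriv, map_add, map_mul, map_sub]
    ring
  | mul_X p i hp =>
    have hX : HasDerivAt (fun t => halfAngleVec t i)
        (MvPolynomial.eval (halfAngleVec θ) (circleDeriv (MvPolynomial.X i))) θ := by
      have hid : HasDerivAt (fun t : ℝ => t / 2) (1 / 2) θ := (hasDerivAt_id θ).div_const 2
      fin_cases i
      · refine hid.cos.congr_deriv ?_
        simp [circleDeriv, halfAngleVec, MvPolynomial.pderiv_X]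
        ring
      · refine hid.sin.congr_deriv ?_
        simp [circleDeriv, halfAngleVec, MvPolynomial.pderiv_X]
        ring
    simp only [map_mul, MvPolynomial.eval_X]
    refine (hp.fun_mul hX).congr_deriv ?_
    simp only [circleDeriv, map_mul, map_sub, map_add, Derivation.leibniz, MvPolynomial.eval_X,
      smul_eq_mul]
    ring

theorem IsBoundedRational.exists_hasDerivAt {f : P1 → ℝ} (hf : IsBoundedRational f) :
    ∃ g : P1 → ℝ, IsBoundedRational g ∧
      ∀ θ, HasDerivAt (fun t => f (circlePt t)) (g (circlePt θ)) θ := by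
  obtain ⟨n, N, D, hN, hD, h⟩ := hf
  obtain ⟨g, hg, hgval⟩ := exists_isBoundedRational
    (((isHomogeneous_circleDeriv hN).mul hD).sub (hN.mul (isHomogeneous_circleDeriv hD)))
    (hD.mul hD) (fun w hw => by
      rw [map_mul]
      exact mul_ne_zero (h w hw).1 (h w hw).1)
  refine ⟨g, hg, fun θ => ?_⟩
  have h1 : (fun t => f (circlePt t)) = fun t =>
      MvPolynomial.eval (halfAngleVec t) N / MvPolynomial.eval (halfAngleVec t) D := by
    ext t
    exact (h _ (halfAngleVec_ne_zero t)).2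
  rw [h1, circlePt_eq_mk, hgval]
  refine ((hasDerivAt_eval_halfAngleVec N θ).fun_div (hasDerivAt_eval_halfAngleVec D θ)
    (h _ (halfAngleVec_ne_zero θ)).1).congr_deriv ?_
  simp only [map_mul, map_sub, pow_two]

theorem IsBoundedRational.continuous {f : P1 → ℝ} (hf : IsBoundedRational f) :
    Continuous fun t => f (circlePt t) := by
  obtain ⟨g, -, hg⟩ := hf.exists_hasDerivAt
  exact continuous_iff_continuousAt.2 fun θ => (hg θ).continuousAt

/-! ### Rationality and length of the spherical trajectories -/

/-- Functions of a pair of reals which are given by a homogeneous polynomial of degree `n`. -/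
def IsForm (n : ℕ) (F : (Fin 2 → ℝ) → ℝ) : Prop :=
  ∃ N : MvPolynomial (Fin 2) ℝ, N.IsHomogeneous n ∧ ∀ w, F w = MvPolynomial.eval w N

namespace IsForm

theorem add {n : ℕ} {F G : (Fin 2 → ℝ) → ℝ} (hF : IsForm n F) (hG : IsForm n G) :
    IsForm n fun w => F w + G w := by
  obtain ⟨N, hN, h⟩ := hF
  obtain ⟨N', hN', h'⟩ := hG
  exact ⟨N + N', hN.add hN', fun w => by simp [h, h']⟩

theorem mul {n m : ℕ} {F G : (Fin 2 → ℝ) → ℝ} (hF : IsForm n F) (hG : IsForm m G) :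
    IsForm (n + m) fun w => F w * G w := by
  obtain ⟨N, hN, h⟩ := hF
  obtain ⟨N', hN', h'⟩ := hG
  exact ⟨N * N', hN.mul hN', fun w => by simp [h, h']⟩

theorem const_mul {n : ℕ} {F : (Fin 2 → ℝ) → ℝ} (c : ℝ) (hF : IsForm n F) :
    IsForm n fun w => c * F w := by
  obtain ⟨N, hN, h⟩ := hF
  refine ⟨MvPolynomial.C c * N, ?_, fun w => by simp [h]⟩
  simpa using (MvPolynomial.isHomogeneous_C (Fin 2) c).mul hN

end IsForm

@[simp] theorem toQuat_re (p : E3) : (toQuat p).re = 0 := rfl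

@[simp] theorem toQuat_imI (p : E3) : (toQuat p).imI = p 0 := rfl

@[simp] theorem toQuat_imJ (p : E3) : (toQuat p).imJ = p 1 := rfl

@[simp] theorem toQuat_imK (p : E3) : (toQuat p).imK = p 2 := rfl

namespace SphericalMotion

theorem isForm_normSq (A : SphericalMotion) :
    IsForm (A.deg + A.deg) fun w => Quaternion.normSq (evalQ w A.poly) := by
  have h0 : IsForm A.deg fun w => (evalQ w A.poly).re := ⟨_, A.homog_re, fun _ => rfl⟩
  have h1 : IsForm A.deg fun w => (evalQ w A.poly).imI := ⟨_, A.homog_imI, fun _ => rfl⟩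
  have h2 : IsForm A.deg fun w => (evalQ w A.poly).imJ := ⟨_, A.homog_imJ, fun _ => rfl⟩
  have h3 : IsForm A.deg fun w => (evalQ w A.poly).imK := ⟨_, A.homog_imK, fun _ => rfl⟩
  convert (((h0.mul h0).add (h1.mul h1)).add (h2.mul h2)).add (h3.mul h3) using 2
  rw [Quaternion.normSq_def']
  ring

theorem isForm_vecPart (A : SphericalMotion) (p : E3) (i : Fin 3) :
    IsForm (A.deg + A.deg) fun w =>
      vecPart (evalQ w A.poly * toQuat p * star (evalQ w A.poly)) i := by
  have h0 : IsForm A.deg fun w => (evalQ w A.poly).re := ⟨_, A.homog_re, fun _ => rfl⟩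
  have h1 : IsForm A.deg fun w => (evalQ w A.poly).imI := ⟨_, A.homog_imI, fun _ => rfl⟩
  have h2 : IsForm A.deg fun w => (evalQ w A.poly).imJ := ⟨_, A.homog_imJ, fun _ => rfl⟩
  have h3 : IsForm A.deg fun w => (evalQ w A.poly).imK := ⟨_, A.homog_imK, fun _ => rfl⟩
  -- The three coordinates are the rows of the unnormalised Euler–Rodrigues rotation matrix applied
  -- to `p`.
  fin_cases i
  · convert ((((((h0.mul h0).add (h1.mul h1)).add ((h2.mul h2).const_mul (-1))).add
      ((h3.mul h3).const_mul (-1))).const_mul (p 0)).add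
      (((h1.mul h2).add ((h0.mul h3).const_mul (-1))).const_mul (2 * p 1))).add
      (((h1.mul h3).add (h0.mul h2)).const_mul (2 * p 2)) using 2
    simp [vecPart]
    ring
  · convert ((((((h0.mul h0).add ((h1.mul h1).const_mul (-1))).add (h2.mul h2)).add
      ((h3.mul h3).const_mul (-1))).const_mul (p 1)).add
      (((h1.mul h2).add (h0.mul h3)).const_mul (2 * p 0))).add
      (((h2.mul h3).add ((h0.mul h1).const_mul (-1))).const_mul (2 * p 2)) using 2
    simp [vecPart]
    ring
  · convert ((((((h0.mul h0).add ((h1.mul h1).const_mul (-1))).add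
      ((h2.mul h2).const_mul (-1))).add (h3.mul h3)).const_mul (p 2)).add
      (((h1.mul h3).add ((h0.mul h2).const_mul (-1))).const_mul (2 * p 0))).add
      (((h2.mul h3).add (h0.mul h1)).const_mul (2 * p 1)) using 2
    simp [vecPart]
    ring

theorem isBoundedRationalCurve_traj (A : SphericalMotion) (p : E3) :
    IsBoundedRationalCurve (A.traj p) := by
  intro i
  obtain ⟨N, hN, hNval⟩ := A.isForm_vecPart p i
  obtain ⟨D, hD, hDval⟩ := A.isForm_normSq
  refine ⟨_, N, D, hN, hD, fun w hw => ⟨?_, ?_⟩⟩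
  · rw [← hDval]
    exact Quaternion.normSq_ne_zero.2 (A.ne_zero w hw)
  · rw [← hNval, ← hDval]
    change rot (evalQ w A.poly) p i = _
    simp [rot, div_eq_inv_mul]

end SphericalMotion

theorem norm_rot {q : ℍ[ℝ]} (hq : q ≠ 0) (p : E3) : ‖rot q p‖ = ‖p‖ := by
  have hn : Quaternion.normSq q ≠ 0 := Quaternion.normSq_ne_zero.2 hq
  have h : ‖vecPart (q * toQuat p * star q)‖ ^ 2 = (Quaternion.normSq q * ‖p‖) ^ 2 := by
    rw [mul_pow, EuclideanSpace.norm_sq_eq, EuclideanSpace.norm_sq_eq, Quaternion.normSq_def']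
    simp [Fin.sum_univ_three, vecPart]
    ring
  have hpos : 0 ≤ Quaternion.normSq q := Quaternion.normSq_nonneg
  have h' := (sq_eq_sq₀ (norm_nonneg _) (mul_nonneg hpos (norm_nonneg _))).1 h
  rw [rot, norm_smul, h', Real.norm_eq_abs, abs_of_nonneg (inv_nonneg.2 hpos),
    inv_mul_cancel_left₀ hn]

theorem SphericalMotion.norm_traj (A : SphericalMotion) (p : E3) (x : P1) :
    ‖A.traj p x‖ = ‖p‖ := by
  induction x using Projectivization.ind with
  | h w hw => exact norm_rot (A.ne_zero w hw) p

/-! ### Trigonometric polynomials and their antiderivatives -/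

/-- The algebra of real trigonometric polynomials. -/
noncomputable def trigPoly : Subalgebra ℝ (ℝ → ℝ) := Algebra.adjoin ℝ {Real.cos, Real.sin}

theorem cos_mem_trigPoly : Real.cos ∈ trigPoly := Algebra.subset_adjoin (by simp)

theorem sin_mem_trigPoly : Real.sin ∈ trigPoly := Algebra.subset_adjoin (by simp)

theorem const_mem_trigPoly (c : ℝ) : (fun _ : ℝ => c) ∈ trigPoly := trigPoly.algebraMap_mem c

theorem continuous_of_mem_trigPoly {f : ℝ → ℝ} (hf : f ∈ trigPoly) : Continuous f := by
  induction hf using Algebra.adjoin_induction with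
  | mem f hf =>
    rcases hf with rfl | rfl
    exacts [Real.continuous_cos, Real.continuous_sin]
  | algebraMap c => exact continuous_const
  | add f g _ _ hf hg => exact hf.add hg
  | mul f g _ _ hf hg => exact hf.mul hg

theorem periodic_of_mem_trigPoly {f : ℝ → ℝ} (hf : f ∈ trigPoly) :
    Function.Periodic f (2 * Real.pi) := by
  induction hf using Algebra.adjoin_induction with
  | mem f hf =>
    rcases hf with rfl | rfl
    exacts [Real.cos_periodic, Real.sin_periodic]
  | algebraMap c => exact fun _ => rfl
  | add f g _ _ hf hg => exact hf.add hg
  | mul f g _ _ hf hg => exact hf.mul hg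

/-- The generators are the coordinates `(u² - v²) / (u² + v²)` and `2uv / (u² + v²)` of the circle,
and bounded rational functions form an algebra. -/
theorem exists_isBoundedRational_of_mem_trigPoly {f : ℝ → ℝ} (hf : f ∈ trigPoly) :
    ∃ F : P1 → ℝ, IsBoundedRational F ∧ ∀ θ, F (circlePt θ) = f θ := by
  have hX := MvPolynomial.isHomogeneous_X (σ := Fin 2) ℝ
  have hD := ((hX 0).mul (hX 0)).add ((hX 1).mul (hX 1))
  have hpos : ∀ w : Fin 2 → ℝ, w ≠ 0 → MvPolynomial.eval w
      (MvPolynomial.X 0 * MvPolynomial.X 0 + MvPolynomial.X 1 * MvPolynomial.X 1) ≠ 0 := by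
    intro w hw h
    simp only [map_add, map_mul, MvPolynomial.eval_X] at h
    apply hw
    ext i
    fin_cases i
    · change w 0 = 0
      nlinarith [sq_nonneg (w 0), sq_nonneg (w 1)]
    · change w 1 = 0
      nlinarith [sq_nonneg (w 0), sq_nonneg (w 1)]
  have hhalf : ∀ θ : ℝ, Real.cos θ = Real.cos (θ / 2) * Real.cos (θ / 2) -
      Real.sin (θ / 2) * Real.sin (θ / 2) ∧
      Real.sin θ = 2 * (Real.cos (θ / 2) * Real.sin (θ / 2)) ∧
      Real.cos (θ / 2) * Real.cos (θ / 2) + Real.sin (θ / 2) * Real.sin (θ / 2) = 1 := by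
    intro θ
    have hc := Real.cos_add (θ / 2) (θ / 2)
    have hs := Real.sin_add (θ / 2) (θ / 2)
    rw [add_halves] at hc hs
    refine ⟨hc, by rw [hs]; ring, ?_⟩
    rw [← pow_two, ← pow_two, Real.cos_sq_add_sin_sq]
  induction hf using Algebra.adjoin_induction with
  | mem f hf =>
    rcases hf with rfl | rfl
    · obtain ⟨F, hF, hval⟩ := exists_isBoundedRational
        (((hX 0).mul (hX 0)).sub ((hX 1).mul (hX 1))) hD hpos
      refine ⟨F, hF, fun θ => ?_⟩
      obtain ⟨h1, -, h3⟩ := hhalf θ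
      rw [circlePt_eq_mk, hval]
      simp [halfAngleVec, h1, h3]
    · have h2 : (MvPolynomial.C 2 * (MvPolynomial.X 0 * MvPolynomial.X 1) :
          MvPolynomial (Fin 2) ℝ).IsHomogeneous (1 + 1) := by
        simpa using (MvPolynomial.isHomogeneous_C (Fin 2) (2 : ℝ)).mul ((hX 0).mul (hX 1))
      obtain ⟨F, hF, hval⟩ := exists_isBoundedRational h2 hD hpos
      refine ⟨F, hF, fun θ => ?_⟩
      obtain ⟨-, h1, h3⟩ := hhalf θ
      rw [circlePt_eq_mk, hval]
      simp [halfAngleVec, h1, h3]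
  | algebraMap c => exact ⟨fun _ => c, .const c, fun _ => rfl⟩
  | add f g _ _ hf hg =>
    obtain ⟨F, hF, hFf⟩ := hf
    obtain ⟨G, hG, hGg⟩ := hg
    exact ⟨_, hF.add hG, fun θ => by simp [hFf, hGg]⟩
  | mul f g _ _ hf hg =>
    obtain ⟨F, hF, hFf⟩ := hf
    obtain ⟨G, hG, hGg⟩ := hg
    exact ⟨_, hF.mul hG, fun θ => by simp [hFf, hGg]⟩

theorem cos_sin_int_mul_mem_trigPoly (n : ℤ) :
    (fun θ : ℝ => Real.cos (n * θ)) ∈ trigPoly ∧ (fun θ : ℝ => Real.sin (n * θ)) ∈ trigPoly := by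
  induction n using Int.induction_on with
  | zero => simpa using ⟨const_mem_trigPoly 1, const_mem_trigPoly 0⟩
  | succ n ih =>
    constructor
    · convert sub_mem (mul_mem ih.1 cos_mem_trigPoly) (mul_mem ih.2 sin_mem_trigPoly) using 1
      ext θ
      push_cast
      simp [add_mul, Real.cos_add]
    · convert add_mem (mul_mem ih.2 cos_mem_trigPoly) (mul_mem ih.1 sin_mem_trigPoly) using 1
      ext θ
      push_cast
      simp [add_mul, Real.sin_add]
  | pred n ih =>
    constructor
    · convert add_mem (mul_mem ih.1 cos_mem_trigPoly) (mul_mem ih.2 sin_mem_trigPoly) using 1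
      ext θ
      simp only [Pi.add_apply, Pi.mul_apply, ← Real.cos_sub]
      push_cast
      ring_nf
    · convert sub_mem (mul_mem ih.2 cos_mem_trigPoly) (mul_mem ih.1 sin_mem_trigPoly) using 1
      ext θ
      simp only [Pi.sub_apply, Pi.mul_apply, ← Real.sin_sub]
      push_cast
      ring_nf

/-- The functions `cos (n θ)` and `sin (n θ)`. -/
def harmonics : Set (ℝ → ℝ) :=
  {f | ∃ n : ℤ, f = (fun θ => Real.cos (n * θ)) ∨ f = fun θ => Real.sin (n * θ)}

/-- Product-to-sum formulas. Linearising products allows trigonometric polynomials to be integrated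
term by term. -/
theorem mul_mem_span_harmonics {f g : ℝ → ℝ} (hf : f ∈ Submodule.span ℝ harmonics)
    (hg : g ∈ Submodule.span ℝ harmonics) : f * g ∈ Submodule.span ℝ harmonics := by
  have hc : ∀ n : ℤ, (fun θ : ℝ => Real.cos (n * θ)) ∈ Submodule.span ℝ harmonics :=
    fun n => Submodule.subset_span ⟨n, Or.inl rfl⟩
  have hs : ∀ n : ℤ, (fun θ : ℝ => Real.sin (n * θ)) ∈ Submodule.span ℝ harmonics :=
    fun n => Submodule.subset_span ⟨n, Or.inr rfl⟩
  have hle : Submodule.span ℝ harmonics * Submodule.span ℝ harmonics ≤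
      Submodule.span ℝ harmonics := by
    rw [Submodule.span_mul_span, Submodule.span_le]
    rintro _ ⟨_, ⟨n, rfl | rfl⟩, _, ⟨m, rfl | rfl⟩, rfl⟩
    · refine Set.mem_of_eq_of_mem ?_ (Submodule.smul_mem _ (1 / 2 : ℝ) (add_mem (hc (n + m)) (hc (n - m))))
      ext θ
      simp [add_mul, sub_mul, Real.cos_add, Real.cos_sub]
      ring
    · refine Set.mem_of_eq_of_mem ?_ (Submodule.smul_mem _ (1 / 2 : ℝ) (sub_mem (hs (n + m)) (hs (n - m))))
      ext θ
      simp [add_mul, sub_mul, Real.sin_add, Real.sin_sub]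
      ring
    · refine Set.mem_of_eq_of_mem ?_ (Submodule.smul_mem _ (1 / 2 : ℝ) (add_mem (hs (n + m)) (hs (n - m))))
      ext θ
      simp [add_mul, sub_mul, Real.sin_add, Real.sin_sub]
      ring
    · refine Set.mem_of_eq_of_mem ?_ (Submodule.smul_mem _ (1 / 2 : ℝ) (sub_mem (hc (n - m)) (hc (n + m))))
      ext θ
      simp [add_mul, sub_mul, Real.cos_add, Real.cos_sub]
      ring
  exact hle (Submodule.mul_mem_mul hf hg)

theorem mem_span_harmonics_of_mem_trigPoly {f : ℝ → ℝ} (hf : f ∈ trigPoly) :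
    f ∈ Submodule.span ℝ harmonics := by
  induction hf using Algebra.adjoin_induction with
  | mem f hf =>
    rcases hf with rfl | rfl
    · exact Submodule.subset_span ⟨1, Or.inl (by simp)⟩
    · exact Submodule.subset_span ⟨1, Or.inr (by simp)⟩
  | algebraMap c =>
    have h1 : (fun θ : ℝ => Real.cos ((0 : ℤ) * θ)) ∈ harmonics := ⟨0, Or.inl rfl⟩
    have h2 : algebraMap ℝ (ℝ → ℝ) c = c • fun θ : ℝ => Real.cos ((0 : ℤ) * θ) := by
      ext θ
      simp
    rw [h2]
    exact Submodule.smul_mem _ c (Submodule.subset_span h1)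
  | add f g _ _ hf hg => exact add_mem hf hg
  | mul f g _ _ hf hg => exact mul_mem_span_harmonics hf hg

/-- Only the harmonics with `n = 0` lack a periodic antiderivative; they are constants and
contribute to `m`, the mean value of `f`. -/
theorem exists_hasDerivAt_sub_const_of_mem_trigPoly {f : ℝ → ℝ} (hf : f ∈ trigPoly) :
    ∃ G ∈ trigPoly, ∃ m : ℝ, ∀ θ, HasDerivAt G (f θ - m) θ := by
  have h := mem_span_harmonics_of_mem_trigPoly hf
  clear hf
  induction h using Submodule.span_induction with
  | mem f hf =>
    obtain ⟨n, hn⟩ := hf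
    rcases eq_or_ne n 0 with rfl | hn0
    · refine ⟨_, const_mem_trigPoly 0, f 0, fun θ => ?_⟩
      rcases hn with rfl | rfl <;> simpa using hasDerivAt_const θ (0 : ℝ)
    have hn0' : (n : ℝ) ≠ 0 := Int.cast_ne_zero.2 hn0
    have hlin : ∀ θ : ℝ, HasDerivAt (fun t : ℝ => n * t) n θ := fun θ => by
      simpa using (hasDerivAt_id θ).const_mul (n : ℝ)
    obtain ⟨h1, h2⟩ := cos_sin_int_mul_mem_trigPoly n
    rcases hn with rfl | rfl
    · refine ⟨_, mul_mem (const_mem_trigPoly (n : ℝ)⁻¹) h2, 0, fun θ => ?_⟩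
      refine ((hlin θ).sin.const_mul (n : ℝ)⁻¹).congr_deriv ?_
      field_simp
      ring
    · refine ⟨_, mul_mem (const_mem_trigPoly (-(n : ℝ)⁻¹)) h1, 0, fun θ => ?_⟩
      refine ((hlin θ).cos.const_mul (-(n : ℝ)⁻¹)).congr_deriv ?_
      field_simp
      ring
  | zero => exact ⟨_, const_mem_trigPoly 0, 0, fun θ => by simpa using hasDerivAt_const θ (0 : ℝ)⟩
  | add f g _ _ hf hg =>
    obtain ⟨F, hF, m, hm⟩ := hf
    obtain ⟨G, hG, m', hm'⟩ := hg
    refine ⟨_, add_mem hF hG, m + m', fun θ => ((hm θ).add (hm' θ)).congr_deriv ?_⟩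
    simp only [Pi.add_apply]
    ring
  | smul c f _ hf =>
    obtain ⟨F, hF, m, hm⟩ := hf
    refine ⟨_, trigPoly.smul_mem hF c, c * m, fun θ => ((hm θ).const_smul c).congr_deriv ?_⟩
    simp only [Pi.smul_apply, smul_eq_mul]
    ring

theorem exists_hasDerivAt_of_mem_trigPoly {f : ℝ → ℝ} (hf : f ∈ trigPoly)
    (h0 : ∫ θ in (0 : ℝ)..2 * Real.pi, f θ = 0) :
    ∃ G ∈ trigPoly, ∀ θ, HasDerivAt G (f θ) θ := by
  obtain ⟨G, hG, m, hm⟩ := exists_hasDerivAt_sub_const_of_mem_trigPoly hf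
  have hc := continuous_of_mem_trigPoly hf
  have h1 := intervalIntegral.integral_eq_sub_of_hasDerivAt (a := 0) (b := 2 * Real.pi)
    (fun θ _ => hm θ) ((hc.sub continuous_const).intervalIntegrable _ _)
  have h2 : G (2 * Real.pi) = G 0 := by simpa using periodic_of_mem_trigPoly hG 0
  rw [intervalIntegral.integral_sub (hc.intervalIntegrable _ _)
    (continuous_const.intervalIntegrable _ _), h0, h2] at h1
  have hm0 : m = 0 := by
    simpa [Real.pi_ne_zero] using h1
  exact ⟨G, hG, fun θ => by simpa [hm0] using hm θ⟩

/-- The even degree matters: each monomial in the cosine and sine of `θ / 2` is then a product of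
their squares and of their mixed product, and these are trigonometric polynomials in `θ`. -/
theorem IsForm.comp_halfAngleVec_mem_trigPoly {k : ℕ} {F : (Fin 2 → ℝ) → ℝ}
    (hF : IsForm (k + k) F) : (fun θ => F (halfAngleVec θ)) ∈ trigPoly := by
  obtain ⟨N, hN, hNval⟩ := hF
  have hcc : (fun θ => Real.cos (θ / 2) ^ 2) ∈ trigPoly := by
    convert mul_mem (const_mem_trigPoly (1 / 2)) (add_mem (const_mem_trigPoly 1) cos_mem_trigPoly)
      using 1
    ext θ
    have h := Real.cos_sq (θ / 2)
    rw [mul_div_cancel₀ θ two_ne_zero] at h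
    simp only [Pi.mul_apply, Pi.add_apply, h]
    ring
  have hss : (fun θ => Real.sin (θ / 2) ^ 2) ∈ trigPoly := by
    convert sub_mem (const_mem_trigPoly 1) hcc using 1
    ext θ
    simp [Real.sin_sq]
  have hcs : (fun θ => Real.cos (θ / 2) * Real.sin (θ / 2)) ∈ trigPoly := by
    convert mul_mem (const_mem_trigPoly (1 / 2)) sin_mem_trigPoly using 1
    ext θ
    have h := Real.sin_two_mul (θ / 2)
    rw [mul_div_cancel₀ θ two_ne_zero] at h
    simp only [Pi.mul_apply, h]
    ring
  have hmono : ∀ a b : ℕ, a + b = k + k →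
      (fun θ => Real.cos (θ / 2) ^ a * Real.sin (θ / 2) ^ b) ∈ trigPoly := by
    intro a b hab
    rcases Nat.even_or_odd' a with ⟨i, rfl | rfl⟩
    · obtain ⟨j, rfl⟩ : ∃ j, b = 2 * j := ⟨k - i, by omega⟩
      convert mul_mem (pow_mem hcc i) (pow_mem hss j) using 1
      ext θ
      simp [pow_mul]
    · obtain ⟨j, rfl⟩ : ∃ j, b = 2 * j + 1 := ⟨k - i - 1, by omega⟩
      convert mul_mem hcs (mul_mem (pow_mem hcc i) (pow_mem hss j)) using 1
      ext θ
      simp [pow_succ, pow_mul]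
      ring
  have hsum : (fun θ => F (halfAngleVec θ)) = ∑ m ∈ N.support, N.coeff m •
      fun θ => Real.cos (θ / 2) ^ m 0 * Real.sin (θ / 2) ^ m 1 := by
    ext θ
    rw [hNval, MvPolynomial.eval_eq']
    simp [halfAngleVec]
  rw [hsum]
  refine sum_mem fun m hm => trigPoly.smul_mem (hmono _ _ ?_) _
  have := hN (MvPolynomial.mem_support_iff.mp hm)
  simpa [Finsupp.weight_apply, Finsupp.sum_fintype] using this

/-- The ideal weight is the negative part `p` of `h`, because `p * h = -p ^ 2`. By Weierstrass it is
approximated uniformly by polynomials in `h`, which remain trigonometric polynomials. In the limit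
`∫ p ^ 2 ≤ 0`, so `p = 0`. -/
theorem nonneg_of_forall_integral_mul_nonneg {h : ℝ → ℝ} (hh : h ∈ trigPoly)
    (hint : ∀ g ∈ trigPoly, (∀ θ, 0 < g θ) → 0 ≤ ∫ θ in (0 : ℝ)..2 * Real.pi, g θ * h θ)
    (θ : ℝ) : 0 ≤ h θ := by
  have hc := continuous_of_mem_trigPoly hh
  have hper := periodic_of_mem_trigPoly hh
  have hpi := Real.two_pi_pos
  obtain ⟨M, hM⟩ : ∃ M, ∀ t, |h t| ≤ M := by
    obtain ⟨M, hM⟩ := (hper.isBounded_of_continuous hpi.ne' hc).exists_norm_le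
    exact ⟨M, fun t => hM _ ⟨t, rfl⟩⟩
  have hM0 : 0 ≤ M := (abs_nonneg _).trans (hM 0)
  let p : ℝ → ℝ := fun t => max 0 (-h t)
  have hp : Continuous p := continuous_const.max hc.neg
  have hp2 : ∀ t, p t * h t = -(p t ^ 2) := by
    intro t
    rcases le_total 0 (h t) with h1 | h1
    · simp [p, h1]
    · simp [p, h1]
      ring
  have hbound : ∀ ε > 0, ∫ t in (0 : ℝ)..2 * Real.pi, p t ^ 2 ≤ ε * (3 * M * (2 * Real.pi)) := by
    intro ε hε
    -- The shift by `2 * ε` exceeds the error `ε`, so the weight is strictly positive, yet it stays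
    -- within `3 * ε` of `p`.
    obtain ⟨q, hq⟩ := exists_polynomial_near_of_continuousOn (-M) M
      (fun t => max 0 (-t) + 2 * ε) (by fun_prop) ε hε
    have hg : Polynomial.aeval h q ∈ trigPoly :=
      Algebra.adjoin_le (Set.singleton_subset_iff.2 hh)
        (Polynomial.aeval_mem_adjoin_singleton ℝ h)
    have hgv : ∀ t, Polynomial.aeval h q t = q.eval (h t) := fun t => by simp
    have hnear : ∀ t, |q.eval (h t) - (p t + 2 * ε)| < ε := fun t =>
      hq _ ⟨(abs_le.1 (hM t)).1, (abs_le.1 (hM t)).2⟩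
    have h1 := hint _ hg fun t => by
      rw [hgv]
      have := (abs_lt.1 (hnear t)).1
      have h0 : 0 ≤ p t := le_max_left _ _
      linarith
    have hle : ∀ t, Polynomial.aeval h q t * h t ≤ -(p t ^ 2) + 3 * ε * M := by
      intro t
      rw [hgv, ← hp2]
      obtain ⟨h2, h3⟩ := abs_lt.1 (hnear t)
      have h4 : |(q.eval (h t) - p t) * h t| ≤ 3 * ε * M := by
        rw [abs_mul]
        refine mul_le_mul ?_ (hM t) (abs_nonneg _) (by linarith)
        rw [abs_le]
        constructor <;> linarith
      have := (abs_le.1 h4).2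
      linarith
    have hgc := continuous_of_mem_trigPoly hg
    have hpc : Continuous fun t => p t ^ 2 := hp.pow 2
    have h2 : ∫ t in (0 : ℝ)..2 * Real.pi, Polynomial.aeval h q t * h t ≤
        ∫ t in (0 : ℝ)..2 * Real.pi, (-(p t ^ 2) + 3 * ε * M) :=
      intervalIntegral.integral_mono hpi.le ((hgc.mul hc).intervalIntegrable _ _)
        ((hpc.fun_neg.fun_add continuous_const).intervalIntegrable _ _) hle
    have h3 : ∫ t in (0 : ℝ)..2 * Real.pi, (-(p t ^ 2) + 3 * ε * M) =
        -(∫ t in (0 : ℝ)..2 * Real.pi, p t ^ 2) + 2 * Real.pi * (3 * ε * M) := by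
      rw [intervalIntegral.integral_add (hpc.fun_neg.intervalIntegrable _ _)
        (continuous_const.intervalIntegrable _ _), intervalIntegral.integral_neg]
      simp
      ring
    have h4 := h1.trans h2
    rw [h3] at h4
    linarith
  have hle0 : ∫ t in (0 : ℝ)..2 * Real.pi, p t ^ 2 ≤ 0 := by
    refine le_of_forall_pos_le_add fun δ hδ => ?_
    -- The summand `1` covers the case `M = 0`.
    have hK : 0 < 3 * M * (2 * Real.pi) + 1 := by positivity
    have h1 := hbound (δ / (3 * M * (2 * Real.pi) + 1)) (by positivity)
    have h2 : δ / (3 * M * (2 * Real.pi) + 1) * (3 * M * (2 * Real.pi)) ≤ δ := by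
      rw [div_mul_eq_mul_div, div_le_iff₀ hK]
      nlinarith
    linarith
  by_contra! hneg
  obtain ⟨t, ht, hteq⟩ := hper.exists_mem_Ico₀ hpi θ
  have hpos : 0 < ∫ t in (0 : ℝ)..2 * Real.pi, p t ^ 2 := by
    refine intervalIntegral.integral_pos hpi (hp.pow 2).continuousOn (fun _ _ => sq_nonneg _)
      ⟨t, ⟨ht.1, ht.2.le⟩, ?_⟩
    have : 0 < p t := lt_max_of_lt_right (by rw [← hteq]; linarith)
    positivity
  linarith

/-! ### Derivatives and integrals of rational curves -/

theorem hasDerivAt_E3 {f : ℝ → E3} {f' : E3} {θ : ℝ}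
    (h : ∀ i, HasDerivAt (fun t => f t i) (f' i) θ) : HasDerivAt f f' θ := by
  have h1 : HasDerivAt (fun t => (f t).ofLp) f'.ofLp θ := hasDerivAt_pi.2 h
  exact (PiLp.continuousLinearEquiv 2 ℝ fun _ : Fin 3 => ℝ).symm.hasFDerivAt.comp_hasDerivAt θ h1

theorem IsBoundedRationalCurve.exists_hasDerivAt {r : P1 → E3} (hr : IsBoundedRationalCurve r) :
    ∃ g : P1 → E3, IsBoundedRationalCurve g ∧
      ∀ θ, HasDerivAt (fun t => r (circlePt t)) (g (circlePt θ)) θ := by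
  choose g hg hderiv using fun i => (hr i).exists_hasDerivAt
  exact ⟨fun x => WithLp.toLp 2 fun i => g i x, hg, fun θ => hasDerivAt_E3 fun i => hderiv i θ⟩

theorem IsBoundedRationalCurve.continuous {r : P1 → E3} (hr : IsBoundedRationalCurve r) :
    Continuous fun t => r (circlePt t) := by
  obtain ⟨g, -, hg⟩ := hr.exists_hasDerivAt
  exact continuous_iff_continuousAt.2 fun θ => (hg θ).continuousAt

theorem IsBoundedRationalCurve.smul {L : P1 → ℝ} {r : P1 → E3} (hL : IsBoundedRational L)
    (hr : IsBoundedRationalCurve r) : IsBoundedRationalCurve fun x => L x • r x :=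
  fun i => hL.mul (hr i)

theorem isCircleIntegral_of_hasDerivAt {r F : P1 → E3}
    (hF : Continuous fun t => F (circlePt t))
    (h : ∀ θ, HasDerivAt (fun t => r (circlePt t)) (F (circlePt θ)) θ) : IsCircleIntegral r F := by
  intro a b
  rw [intervalIntegral.integral_eq_sub_of_hasDerivAt (fun θ _ => h θ) (hF.intervalIntegrable _ _)]
  abel

theorem IsCircleIntegral.hasDerivAt {r F : P1 → E3} (hF : Continuous fun t => F (circlePt t))
    (h : IsCircleIntegral r F) (θ : ℝ) :
    HasDerivAt (fun t => r (circlePt t)) (F (circlePt θ)) θ := by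
  have h1 : (fun t => r (circlePt t)) =
      fun t => r (circlePt 0) + ∫ s in (0 : ℝ)..t, F (circlePt s) := by
    ext1 t
    exact h 0 t
  rw [h1]
  exact (hF.integral_hasStrictDerivAt 0 θ).hasDerivAt.const_add _

/-! ### Framing motions and positive rational weights -/

/-- The first condition of the theorem: `A` extends to a rational framing motion of a regular
curve, with tangential frame axis `e`. -/
def HasFramingExtension (A : SphericalMotion) (e : E3) : Prop :=
  ∃ (r : P1 → E3) (M : P1 → E3 → E3),
    IsRegularBoundedRationalCurve r ∧ Extends M A ∧ IsBoundedRationalMotion M ∧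
      IsFramingMotion M e r

/-- The third condition of the theorem: the spherical trajectory of `e`, weighted by a positive
bounded rational function, integrates to a rational closed curve. -/
def HasRationalIntegral (A : SphericalMotion) (e : E3) : Prop :=
  ∃ L : P1 → ℝ, IsBoundedRational L ∧ (∀ x, 0 < L x) ∧
    ∃ r : P1 → E3, IsBoundedRationalCurve r ∧
      IsCircleIntegral r (fun x => L x • A.traj e x)

theorem SphericalMotion.traj_zero (A : SphericalMotion) (x : P1) : A.traj 0 x = 0 :=
  norm_eq_zero.1 ((A.norm_traj 0 x).trans norm_zero)

theorem HasFramingExtension.hasRationalIntegral {A : SphericalMotion} {e : E3} (he : ‖e‖ = 1)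
    (h : HasFramingExtension A e) : HasRationalIntegral A e := by
  obtain ⟨r, M, ⟨hr, hreg⟩, ⟨r', hM⟩, -, -, hframe⟩ := h
  obtain ⟨g, hg, hderiv⟩ := hr.exists_hasDerivAt
  have hT := A.isBoundedRationalCurve_traj e
  -- The framing condition gives only a pointwise factor `c`. As the trajectory has unit length, `c`
  -- is this inner product, which is visibly rational.
  let L : P1 → ℝ := fun x => g x 0 * A.traj e x 0 + g x 1 * A.traj e x 1 + g x 2 * A.traj e x 2
  have hL : IsBoundedRational L :=
    (((hg 0).mul (hT 0)).add ((hg 1).mul (hT 1))).add ((hg 2).mul (hT 2))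
  have hgL : ∀ x, g x = L x • A.traj e x := by
    intro x
    obtain ⟨θ, rfl⟩ := circlePt_surjective x
    obtain ⟨c, hc⟩ := hframe θ
    have hv : velocity r θ = g (circlePt θ) := (hderiv θ).deriv
    rw [hM, hM, A.traj_zero, add_zero, add_sub_cancel_left, hv] at hc
    have hnorm : ‖A.traj e (circlePt θ)‖ ^ 2 = 1 := by rw [A.norm_traj, he, one_pow]
    rw [EuclideanSpace.norm_sq_eq] at hnorm
    simp only [Fin.sum_univ_three, Real.norm_eq_abs, sq_abs] at hnorm
    have hLc : L (circlePt θ) = c := by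
      simp only [L, hc, PiLp.smul_apply, smul_eq_mul]
      linear_combination c * hnorm
    rw [hLc, hc]
  have hL0 : ∀ θ, L (circlePt θ) ≠ 0 := by
    intro θ h0
    apply hreg θ
    rw [velocity, (hderiv θ).deriv, hgL, h0, zero_smul]
  have hLcont := hL.continuous
  have hsign : (∀ x, 0 < L x) ∨ ∀ x, L x < 0 := by
    by_contra! hcon
    obtain ⟨⟨x, hx⟩, ⟨y, hy⟩⟩ := hcon
    obtain ⟨a, rfl⟩ := circlePt_surjective x
    obtain ⟨b, rfl⟩ := circlePt_surjective y
    obtain ⟨t, ht⟩ := mem_range_of_exists_le_of_exists_ge hLcont ⟨a, hx⟩ ⟨b, hy⟩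
    exact hL0 t ht
  rcases hsign with hpos | hneg
  · refine ⟨L, hL, hpos, r, hr, isCircleIntegral_of_hasDerivAt
      (hLcont.smul hT.continuous) fun θ => ?_⟩
    rw [← hgL]
    exact hderiv θ
  -- If the curve runs against the frame axis, its reflection in the origin runs along it.
  · refine ⟨fun x => -L x, hL.neg, fun x => neg_pos.2 (hneg x), fun x => -r x,
      fun i => (hr i).neg, isCircleIntegral_of_hasDerivAt
      (hLcont.neg.smul hT.continuous) fun θ => ?_⟩
    rw [neg_smul, ← hgL]
    exact (hderiv θ).fun_neg

theorem HasRationalIntegral.hasFramingExtension {A : SphericalMotion} {e : E3} (he : ‖e‖ = 1)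
    (h : HasRationalIntegral A e) : HasFramingExtension A e := by
  obtain ⟨L, hL, hpos, r, hr, hint⟩ := h
  have hT := A.isBoundedRationalCurve_traj e
  have hv : ∀ θ, velocity r θ = L (circlePt θ) • A.traj e (circlePt θ) := fun θ =>
    (hint.hasDerivAt (hL.continuous.smul hT.continuous) θ).deriv
  refine ⟨r, fun x p => r x + A.traj p x, ⟨hr, fun θ => ?_⟩, ⟨r, fun _ _ => rfl⟩,
    fun p i => (hr i).add (A.isBoundedRationalCurve_traj p i),
    fun x => by simp [A.traj_zero], fun θ => ⟨L (circlePt θ), ?_⟩⟩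
  · rw [hv]
    refine smul_ne_zero (hpos _).ne' (norm_ne_zero_iff.1 ?_)
    rw [A.norm_traj, he]
    exact one_ne_zero
  · simp only [hv, A.traj_zero, add_zero, add_sub_cancel_left]

/-! ### A closed integral curve forces the origin into the relative interior -/

theorem eq_of_monotone_of_periodic {f : ℝ → ℝ} {c : ℝ} (hc : 0 < c) (hf : Monotone f)
    (hper : Function.Periodic f c) (x y : ℝ) : f x = f y := by
  have key : ∀ x y, f x ≤ f y := by
    intro x y
    obtain ⟨n, hn⟩ := Archimedean.arch (x - y) hc
    rw [← hper.nsmul n y]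
    exact hf (by linarith)
  exact le_antisymm (key x y) (key y x)

/-- If `f` is nonnegative on the trajectory, `f ∘ r` never decreases around the closed curve, so it
is constant. Its derivative `L * f T` vanishes, and `L > 0` leaves `f T = 0`. -/
theorem HasRationalIntegral.zero_mem_intrinsicInterior {A : SphericalMotion} {e : E3}
    (h : HasRationalIntegral A e) :
    (0 : E3) ∈ intrinsicInterior ℝ (convexHull ℝ (Set.range (A.traj e))) := by
  obtain ⟨L, hL, hpos, r, hr, hint⟩ := h
  have hT := A.isBoundedRationalCurve_traj e
  have hderiv := hint.hasDerivAt (hL.continuous.smul hT.continuous)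
  refine (convex_convexHull ℝ _).zero_mem_intrinsicInterior
    ⟨_, subset_convexHull ℝ _ ⟨circlePt 0, rfl⟩⟩ fun f hf => ?_
  have hd : ∀ θ, HasDerivAt (fun t => f (r (circlePt t)))
      (L (circlePt θ) * f (A.traj e (circlePt θ))) θ := by
    intro θ
    have := (LinearMap.toContinuousLinearMap f).hasFDerivAt.comp_hasDerivAt θ (hderiv θ)
    simpa [Function.comp_def] using this
  have hmono : Monotone fun t => f (r (circlePt t)) := by
    refine monotone_of_deriv_nonneg (fun θ => (hd θ).differentiableAt) fun θ => ?_
    rw [(hd θ).deriv]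
    exact mul_nonneg (hpos _).le (hf _ (subset_convexHull ℝ _ ⟨_, rfl⟩))
  have hconst : (fun t => f (r (circlePt t))) = fun _ => f (r (circlePt 0)) := by
    ext t
    exact eq_of_monotone_of_periodic Real.two_pi_pos hmono
      (fun t => by simp only [circlePt_add_two_pi]) t 0
  have hle : convexHull ℝ (Set.range (A.traj e)) ⊆ LinearMap.ker f := by
    refine convexHull_min ?_ (LinearMap.ker f).convex
    rintro _ ⟨x, rfl⟩
    obtain ⟨θ, rfl⟩ := circlePt_surjective x
    have h1 := hd θ
    rw [hconst] at h1
    exact (mul_eq_zero.1 (h1.unique (hasDerivAt_const θ _))).resolve_left (hpos _).ne'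
  exact fun x hx => hle hx

/-! ### Constructing the weight from the convexity condition -/

/-- The integrals over the circle of a function with values in three-space, with positive
trigonometric polynomials as weights. -/
def weightedIntegrals (P : Fin 3 → ℝ → ℝ) : Set E3 :=
  {v | ∃ g ∈ trigPoly, (∀ θ, 0 < g θ) ∧
    ∀ i, v i = ∫ θ in (0 : ℝ)..2 * Real.pi, g θ * P i θ}

theorem convex_weightedIntegrals {P : Fin 3 → ℝ → ℝ} (hP : ∀ i, Continuous (P i)) :
    Convex ℝ (weightedIntegrals P) := by
  rintro v ⟨g, hg, hgpos, hgv⟩ w ⟨k, hk, hkpos, hkw⟩ a b ha hb hab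
  have hgc := continuous_of_mem_trigPoly hg
  have hkc := continuous_of_mem_trigPoly hk
  refine ⟨a • g + b • k, add_mem (trigPoly.smul_mem hg a) (trigPoly.smul_mem hk b),
    fun θ => ?_, fun i => ?_⟩
  · have h1 := hgpos θ
    have h2 := hkpos θ
    simp only [Pi.add_apply, Pi.smul_apply, smul_eq_mul]
    rcases ha.eq_or_lt with rfl | ha
    · have : b = 1 := by linarith
      simpa [this] using h2
    · have := mul_pos ha h1
      have := mul_nonneg hb h2.le
      linarith
  · simp only [PiLp.add_apply, PiLp.smul_apply, smul_eq_mul, hgv, hkw, Pi.add_apply,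
      Pi.smul_apply, add_mul, mul_assoc]
    rw [intervalIntegral.integral_add, intervalIntegral.integral_const_mul,
      intervalIntegral.integral_const_mul]
    · exact (continuous_const.mul (hgc.mul (hP i))).intervalIntegrable _ _
    · exact (continuous_const.mul (hkc.mul (hP i))).intervalIntegrable _ _

/-- The dual criterion is applied to the set of weighted integrals. A functional commutes with the
integral, so nonnegativity on this set means that `f ∘ P` has nonnegative integral against every
positive weight, hence is nonnegative pointwise. -/
theorem zero_mem_weightedIntegrals {P : Fin 3 → ℝ → ℝ} (hP : ∀ i, P i ∈ trigPoly)
    (h : ∀ f : E3 →ₗ[ℝ] ℝ, (∀ θ, 0 ≤ f (WithLp.toLp 2 fun i => P i θ)) →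
      ∀ θ, f (WithLp.toLp 2 fun i => P i θ) = 0) :
    (0 : E3) ∈ weightedIntegrals P := by
  have hPc := fun i => continuous_of_mem_trigPoly (hP i)
  refine intrinsicInterior_subset ((convex_weightedIntegrals hPc).zero_mem_intrinsicInterior
    ⟨WithLp.toLp 2 fun i => ∫ θ in (0 : ℝ)..2 * Real.pi, 1 * P i θ, fun _ => 1,
      const_mem_trigPoly 1, fun _ => one_pos, fun i => rfl⟩ fun f hf => ?_)
  obtain ⟨c, hfv⟩ : ∃ c : Fin 3 → ℝ, ∀ v : E3, f v = ∑ i, v i * c i := by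
    refine ⟨fun i => f (EuclideanSpace.single i 1), fun v => ?_⟩
    conv_lhs => rw [← (EuclideanSpace.basisFun (Fin 3) ℝ).sum_repr v]
    simp
  let k : ℝ → ℝ := fun θ => f (WithLp.toLp 2 fun i => P i θ)
  have hk : k ∈ trigPoly := by
    have : k = ∑ i, c i • P i := by
      ext θ
      simp [k, hfv, mul_comm]
    rw [this]
    exact sum_mem fun i _ => trigPoly.smul_mem (hP i) _
  have hfint : ∀ g ∈ trigPoly, ∀ v : E3,
      (∀ i, v i = ∫ θ in (0 : ℝ)..2 * Real.pi, g θ * P i θ) →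
      f v = ∫ θ in (0 : ℝ)..2 * Real.pi, g θ * k θ := by
    intro g hg v hv
    have hgc := continuous_of_mem_trigPoly hg
    have h1 : ∀ θ, g θ * k θ = ∑ i, g θ * P i θ * c i := by
      intro θ
      simp only [k, hfv, Finset.mul_sum, mul_assoc]
    simp only [h1]
    rw [intervalIntegral.integral_finsetSum fun i _ =>
      ((hgc.fun_mul (hPc i)).fun_mul continuous_const).intervalIntegrable _ _, hfv]
    simp only [intervalIntegral.integral_mul_const, hv]
  have hk0 : ∀ θ, k θ = 0 := h f <| nonneg_of_forall_integral_mul_nonneg hk fun g hg hgpos => by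
    have h1 := hf (WithLp.toLp 2 fun i => ∫ θ in (0 : ℝ)..2 * Real.pi, g θ * P i θ)
      ⟨g, hg, hgpos, fun _ => rfl⟩
    rwa [hfint g hg _ fun _ => rfl] at h1
  rintro v ⟨g, hg, -, hv⟩
  rw [hfint g hg v hv]
  simp [hk0]

/-- Multiplying by the positive norm `Q` clears the denominator of the trajectory without changing
the sign of any functional on it. The weight `g * Q` turns the trajectory into `g * P`, a
trigonometric polynomial whose integral over the circle vanishes. -/
theorem hasRationalIntegral_of_zero_mem_intrinsicInterior {A : SphericalMotion} {e : E3}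
    (h : (0 : E3) ∈ intrinsicInterior ℝ (convexHull ℝ (Set.range (A.traj e)))) :
    HasRationalIntegral A e := by
  let Q : ℝ → ℝ := fun θ => Quaternion.normSq (evalQ (halfAngleVec θ) A.poly)
  let P : Fin 3 → ℝ → ℝ := fun i θ => vecPart
    (evalQ (halfAngleVec θ) A.poly * toQuat e * star (evalQ (halfAngleVec θ) A.poly)) i
  have hQ : Q ∈ trigPoly := A.isForm_normSq.comp_halfAngleVec_mem_trigPoly
  have hP : ∀ i, P i ∈ trigPoly := fun i => (A.isForm_vecPart e i).comp_halfAngleVec_mem_trigPoly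
  have hQpos : ∀ θ, 0 < Q θ := fun θ => lt_of_le_of_ne Quaternion.normSq_nonneg
    (Quaternion.normSq_ne_zero.2 (A.ne_zero _ (halfAngleVec_ne_zero θ))).symm
  have hPT : ∀ θ, (WithLp.toLp 2 fun i => P i θ : E3) = Q θ • A.traj e (circlePt θ) := by
    intro θ
    change vecPart _ = Q θ • ((Q θ)⁻¹ • vecPart _)
    rw [smul_inv_smul₀ (hQpos θ).ne']
    rfl
  have h0 : (0 : E3) ∈ weightedIntegrals P := by
    refine zero_mem_weightedIntegrals hP fun f hf θ => ?_
    have hle : convexHull ℝ (Set.range (A.traj e)) ⊆ {x | 0 ≤ f x} := by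
      refine convexHull_min ?_ (convex_halfSpace_ge f.isLinear 0)
      rintro _ ⟨x, rfl⟩
      obtain ⟨t, rfl⟩ := circlePt_surjective x
      have h1 := hf t
      rw [hPT, map_smul, smul_eq_mul] at h1
      exact nonneg_of_mul_nonneg_right h1 (hQpos t)
    rw [hPT, map_smul, eq_zero_of_zero_mem_intrinsicInterior h f (fun x hx => hle hx)
      (subset_convexHull ℝ _ ⟨_, rfl⟩), smul_zero]
  obtain ⟨g, hg, hgpos, hgint⟩ := h0
  obtain ⟨L, hL, hLval⟩ := exists_isBoundedRational_of_mem_trigPoly (mul_mem hg hQ)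
  choose G hG hGderiv using fun i =>
    exists_hasDerivAt_of_mem_trigPoly (mul_mem hg (hP i)) (hgint i).symm
  choose R hR hRval using fun i => exists_isBoundedRational_of_mem_trigPoly (hG i)
  refine ⟨L, hL, fun x => ?_, fun x => WithLp.toLp 2 fun i => R i x, hR,
    isCircleIntegral_of_hasDerivAt
      (hL.continuous.smul (A.isBoundedRationalCurve_traj e).continuous)
      fun θ => hasDerivAt_E3 fun i => ?_⟩
  · obtain ⟨θ, rfl⟩ := circlePt_surjective x
    rw [hLval]
    exact mul_pos (hgpos θ) (hQpos θ)
  · have h1 : (fun t => R i (circlePt t)) = G i := funext (hRval i)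
    have h2 : (L (circlePt θ) • A.traj e (circlePt θ)) i = (g * P i) θ := by
      have h3 : P i θ = Q θ * A.traj e (circlePt θ) i := congrArg (fun v : E3 => v i) (hPT θ)
      rw [PiLp.smul_apply, smul_eq_mul, hLval, Pi.mul_apply, Pi.mul_apply, h3, mul_assoc]
    rw [h2]
    simpa only [h1] using hGderiv i θ

end FramingMotion

open FramingMotion in
theorem mainTheorem1 (A : SphericalMotion) (e : E3) (he : ‖e‖ = 1) :
    ((∃ (r : P1 → E3) (M : P1 → E3 → E3),
        IsRegularBoundedRationalCurve r ∧ Extends M A ∧ IsBoundedRationalMotion M ∧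
          IsFramingMotion M e r) ↔
      (0 : E3) ∈ intrinsicInterior ℝ (convexHull ℝ (Set.range (A.traj e)))) ∧
    ((∃ (r : P1 → E3) (M : P1 → E3 → E3),
        IsRegularBoundedRationalCurve r ∧ Extends M A ∧ IsBoundedRationalMotion M ∧
          IsFramingMotion M e r) ↔
      ∃ L : P1 → ℝ, IsBoundedRational L ∧ (∀ x, 0 < L x) ∧
        ∃ r : P1 → E3, IsBoundedRationalCurve r ∧
          IsCircleIntegral r (fun x => L x • A.traj e x)) := by
  have h13 : HasFramingExtension A e ↔ HasRationalIntegral A e :=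
    ⟨fun h => h.hasRationalIntegral he, fun h => h.hasFramingExtension he⟩
  exact ⟨h13.trans ⟨fun h => h.zero_mem_intrinsicInterior,
    hasRationalIntegral_of_zero_mem_intrinsicInterior⟩, h13⟩
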